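/- Let $m\ge 1$ be an integer, let $p$ be a prime dividing $m$ (so $m\ge 2$), and let $E_m(x)=\sum_{i=0}^m \frac{x^i}{i!}$ be the truncated exponential polynomial of degree $m$. Let $f(x)=a_dx^d+\cdots+a_0\in\mathbb{Q}[x]$ be a polynomial of degree $d$ such that $\nu_p(a_d)=0$ and $f(x)\equiv a_dx^d \pmod p$, i.e. for every $i<d$ either $a_i=0$ or $\nu_p(a_i)\ge 1$, where $\nu_p$ is the $p$-adic valuation on $\mathbb{Q}$. If $d$ is coprime to $m!$, then $f$ is dynamically irreducible at $E_m$; that is, $E_m\circ f^n$ is irreducible over $\mathbb{Q}$ for all $n\ge 0$, where $f^n$ denotes the $n$-th iterate of $f$ under composition and $f^0(x)=x$. -/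

import Mathlib

open Polynomial

/-- Congruence modulo a prime `p` of polynomials with rational coefficients: every coefficient of
the difference is zero or has positive `p`-adic valuation, that is, the difference lies in
`p ℤ_(p)[x]`. -/
def PolyCongrMod (p : ℕ) (f g : ℚ[X]) : Prop :=
  ∀ i : ℕ, (f - g).coeff i = 0 ∨ 0 < padicValRat p ((f - g).coeff i)

/-- The `n`-th iterate of `f` under composition, with `f^0 = x`. -/
noncomputable def polyIterate (f : ℚ[X]) : ℕ → ℚ[X]
  | 0 => X
  | n + 1 => f.comp (polyIterate f n)

/-- `f` is dynamically irreducible at `g` if `g ∘ f^n` is irreducible over `ℚ` for all `n ≥ 0`. -/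
def DynamicallyIrreducibleAt (f g : ℚ[X]) : Prop :=
  ∀ n : ℕ, Irreducible (g.comp (polyIterate f n))

/-- The truncated exponential polynomial `1 + x + x^2/2! + ⋯ + x^m/m!`. -/
noncomputable def truncatedExp (m : ℕ) : ℚ[X] :=
  ∑ i ∈ Finset.range (m + 1), C (1 / (Nat.factorial i : ℚ)) * X ^ i

/-! ### Newton polygon of the truncated exponential at a prime -/

section FactorialValuation

open Nat

variable {q : ℕ} [hq : Fact q.Prime]

/-! Let `β` be a root of `E_m ∘ f^n` in a number field `K`, and put `α = f^n(β)`. It suffices that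
`m * d ^ n` divides `[K : ℚ]`: for `K` generated by a root of an irreducible factor, that factor
then has full degree. Since `[K : ℚ]` is a sum of terms `e * (residue degree)` over the primes above
a given `q`, divisibility of every ramification index `e` is enough.

Two terms of `E_m(α) = 0` must share the minimal valuation, which forces `w * q ^ k = e * ν_q((q ^
k)!)` with `w = v(α)` and `ν_q(m) ≤ k` (`exists_slope_eq`). As `ν_q((q ^ k)!) = 1 + q + ⋯ + q ^ (k -
1)` is prime to `q` for `k > 0`, `q ^ ν_q(m)` divides `e`; varying `q` gives `m`.

At `q = p` one has `0 < w < e`, so in `f(γ)` of valuation `w` only the leading term matters and `w =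
d * v(γ)`. Iterating, `d ^ n` divides `w`, hence `e * ν_p((p ^ k)!)`, hence `e`, because `ν_p((p ^
k)!)` divides `m!`. Finally `m` and `d ^ n` are coprime. -/

theorem sub_one_mul_padicValNat_factorial_prime_pow (n : ℕ) :
    ((q : ℤ) - 1) * padicValNat q (q ^ n)! = q ^ n - 1 := by
  induction n with
  | zero => simp
  | succ n ih =>
    rw [pow_succ', padicValNat_factorial_mul]
    rw [Nat.cast_add, mul_add, ih, Nat.cast_pow]
    ring

theorem padicValNat_factorial_add_le (i j : ℕ) :
    padicValNat q i ! + padicValNat q j ! ≤ padicValNat q (i + j)! := by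
  rw [← padicValNat.mul (factorial_ne_zero i) (factorial_ne_zero j)]
  exact (padicValNat_dvd_iff_le (factorial_ne_zero _)).1
    (pow_padicValNat_dvd.trans (factorial_mul_factorial_dvd_factorial_add i j))

/-- Adding a multiple of `q ^ n` does not change the valuation of a positive integer below `q ^ n`.
-/
theorem padicValNat_factorial_add_of_lt_pow {a n r : ℕ} (hr : r < q ^ n) :
    padicValNat q (q ^ n * a + r)! = padicValNat q (q ^ n * a)! + padicValNat q r ! := by
  induction r with
  | zero => simp
  | succ r ih =>
    have key : padicValNat q (q ^ n * a + r + 1) = padicValNat q (r + 1) := by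
      apply le_antisymm
      · refine (padicValNat_dvd_iff_le (Nat.succ_ne_zero _)).1 ?_
        by_cases h : padicValNat q (q ^ n * a + r + 1) ≤ n
        · have h1 : q ^ padicValNat q (q ^ n * a + r + 1) ∣ q ^ n * a + (r + 1) :=
            pow_padicValNat_dvd
          exact (Nat.dvd_add_right (Dvd.dvd.mul_right (pow_dvd_pow q h) a)).1 h1
        · have h1 : q ^ n ∣ q ^ n * a + (r + 1) :=
            (pow_dvd_pow q (not_le.1 h).le).trans pow_padicValNat_dvd
          have h2 := (Nat.dvd_add_right (Dvd.intro a rfl)).1 h1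
          exact absurd (Nat.le_of_dvd (Nat.succ_pos _) h2) (not_le.2 hr)
      · refine (padicValNat_dvd_iff_le (Nat.succ_ne_zero _)).1 ?_
        have h1 : q ^ padicValNat q (r + 1) ∣ r + 1 := pow_padicValNat_dvd
        have h2 : padicValNat q (r + 1) ≤ n := by
          by_contra h
          have h3 := Nat.le_of_dvd (Nat.succ_pos _) ((pow_dvd_pow q (not_le.1 h).le).trans h1)
          exact absurd h3 (not_le.2 hr)
        exact dvd_add (Dvd.dvd.mul_right (pow_dvd_pow q h2) a) h1
    rw [← add_assoc, factorial_succ, factorial_succ,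
      padicValNat.mul (Nat.succ_ne_zero _) (factorial_ne_zero _),
      padicValNat.mul (Nat.succ_ne_zero _) (factorial_ne_zero _), ih (by omega), key, Nat.succ_eq_add_one]
    omega

/-- Termwise comparison in Legendre's formula: `q ^ j * ⌊r / q ^ j⌋ ≤ r`, and only `j ≤ n`
contribute. -/
theorem pow_mul_padicValNat_factorial_le {n r : ℕ} (hr : r < q ^ (n + 1)) :
    q ^ n * padicValNat q r ! ≤ r * padicValNat q (q ^ n)! := by
  have hq1 := hq.out.one_lt
  rw [padicValNat_factorial (b := n + 1) (Nat.log_lt_of_lt_pow' (Nat.succ_ne_zero _) hr),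
    padicValNat_factorial (b := n + 1) (by rw [Nat.log_pow hq1]; omega),
    Finset.mul_sum, Finset.mul_sum]
  refine Finset.sum_le_sum fun j hj => ?_
  have hj : j ≤ n := by have := Finset.mem_Ico.1 hj; omega
  rw [Nat.pow_div hj hq1.le]
  calc q ^ n * (r / q ^ j) = q ^ (n - j) * (q ^ j * (r / q ^ j)) := by
        rw [← mul_assoc, ← pow_add, Nat.sub_add_cancel hj]
    _ ≤ q ^ (n - j) * r := Nat.mul_le_mul_left _ (Nat.mul_div_le _ _)
    _ = _ := mul_comm _ _

theorem padicValNat_factorial_prime_pow_slope_lt {n k : ℕ} (h : n < k) :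
    padicValNat q (q ^ n)! * q ^ k < padicValNat q (q ^ k)! * q ^ n := by
  have hq1 : (1 : ℤ) < q := mod_cast hq.out.one_lt
  have h1 := sub_one_mul_padicValNat_factorial_prime_pow (q := q) n
  have h2 := sub_one_mul_padicValNat_factorial_prime_pow (q := q) k
  have h3 : (q : ℤ) ^ n < q ^ k := pow_lt_pow_right₀ hq1 h
  rw [← Nat.cast_lt (α := ℤ)]
  simp only [Nat.cast_mul, Nat.cast_pow]
  refine lt_of_mul_lt_mul_left (a := (q : ℤ) - 1) ?_ (by linarith)
  rw [← mul_assoc, ← mul_assoc, h1, h2]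
  linarith

variable {m : ℕ} {e w : ℤ} {i : ℕ}

/-- Here `i * w - e * ν_q(i!)` is the valuation of `α ^ i / i!` when `v(α) = w` and `v(q) = e`.
Compare the indices `i` and `i + q ^ n`. -/
theorem slope_le_of_minimizer (he : 0 ≤ e)
    (hmin : ∀ j ≤ m, i * w - e * padicValNat q i ! ≤ j * w - e * padicValNat q j !)
    {n : ℕ} (hin : i + q ^ n ≤ m) : e * padicValNat q (q ^ n)! ≤ w * q ^ n := by
  have h1 := hmin _ hin
  have h2 : (padicValNat q i ! : ℤ) + padicValNat q (q ^ n)! ≤ padicValNat q (i + q ^ n)! :=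
    mod_cast padicValNat_factorial_add_le (q := q) i (q ^ n)
  have h3 := mul_le_mul_of_nonneg_left h2 he
  simp only [Nat.cast_add, Nat.cast_pow] at h1
  linarith

/-- Otherwise removing from `i` its nonzero remainder modulo `q ^ (n + 1)` would lower the
valuation. -/
theorem pow_succ_dvd_of_minimizer (he : 0 ≤ e) (him : i ≤ m)
    (hmin : ∀ j ≤ m, i * w - e * padicValNat q i ! ≤ j * w - e * padicValNat q j !)
    {n : ℕ} (hn : e * padicValNat q (q ^ n)! < w * q ^ n) : q ^ (n + 1) ∣ i := by
  by_contra hdvd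
  have hr : i % q ^ (n + 1) < q ^ (n + 1) := Nat.mod_lt _ (pow_pos hq.out.pos _)
  have hr0 : 0 < i % q ^ (n + 1) := Nat.pos_of_ne_zero fun h => hdvd (Nat.dvd_of_mod_eq_zero h)
  have hi := Nat.div_add_mod i (q ^ (n + 1))
  generalize i % q ^ (n + 1) = r at *
  have h1 := padicValNat_factorial_add_of_lt_pow (a := i / q ^ (n + 1)) hr
  generalize q ^ (n + 1) * (i / q ^ (n + 1)) = t at *
  subst hi
  have h2 := hmin t (by omega)
  rw [h1] at h2
  have h3 : (q ^ n * padicValNat q r ! : ℤ) ≤ r * padicValNat q (q ^ n)! :=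
    mod_cast pow_mul_padicValNat_factorial_le hr
  have h4 := mul_le_mul_of_nonneg_left h3 he
  have h5 : (r : ℤ) * w ≤ e * padicValNat q r ! := by
    simp only [Nat.cast_add] at h2
    linarith
  have h6 := mul_le_mul_of_nonneg_left h5 (pow_nonneg (Int.natCast_nonneg q) n)
  have h7 := mul_lt_mul_of_pos_left hn (show (0 : ℤ) < r by exact_mod_cast hr0)
  linarith

/-- A minimizer `i < m` would lie in the last block of length `q ^ k` before `m`, and moving up to
`m` would then lower the valuation. -/
theorem eq_of_minimizer_of_slope_lt (he : 0 ≤ e) (him : i ≤ m)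
    (hmin : ∀ j ≤ m, i * w - e * padicValNat q i ! ≤ j * w - e * padicValNat q j !)
    {k : ℕ} (hkm : q ^ k ∣ m) (hk : w * q ^ k < e * padicValNat q (q ^ k)!) : i = m := by
  by_contra hne
  have hlt : m < i + q ^ k := by
    by_contra h
    exact absurd (slope_le_of_minimizer he hmin (not_lt.1 h)) (not_le.2 hk)
  obtain ⟨a, rfl⟩ := hkm
  obtain ⟨b, rfl⟩ : ∃ b, a = b + 1 := Nat.exists_eq_succ_of_ne_zero (by rintro rfl; omega)
  rw [mul_add, mul_one] at *
  obtain ⟨s, rfl⟩ : ∃ s, i = q ^ k * b + s := Nat.exists_eq_add_of_le (by omega)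
  have hs : s < q ^ k := by omega
  have h1 := padicValNat_factorial_add_of_lt_pow (a := b) hs
  have h2 : (padicValNat q (q ^ k * b)! : ℤ) + padicValNat q (q ^ k)! ≤
      padicValNat q (q ^ k * b + q ^ k)! :=
    mod_cast padicValNat_factorial_add_le (q := q) (q ^ k * b) (q ^ k)
  have h3 : (q ^ k * padicValNat q s ! : ℤ) ≤ s * padicValNat q (q ^ k)! :=
    mod_cast pow_mul_padicValNat_factorial_le
      (hs.trans_le (Nat.pow_le_pow_right hq.out.pos k.le_succ))
  have h4 := hmin _ le_rfl
  rw [h1] at h4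
  simp only [Nat.cast_add, Nat.cast_mul, Nat.cast_pow] at h4
  have h5 := mul_le_mul_of_nonneg_left h2 he
  have h6 := mul_le_mul_of_nonneg_left h3 he
  have h7 : e * padicValNat q (q ^ k)! - e * padicValNat q s ! ≤ (q ^ k - s) * w := by linarith
  have h8 := mul_le_mul_of_nonneg_left h7 (pow_nonneg (Int.natCast_nonneg q) k)
  have h9 := mul_lt_mul_of_pos_left hk
    (show (0 : ℤ) < q ^ k - s by have : (s : ℤ) < q ^ k := by exact_mod_cast hs
                                 linarith)
  linarith

theorem exists_slope_eq (he : 0 < e)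
    (h : ¬∃ i ≤ m, ∀ j ≤ m, j ≠ i →
      i * w - e * padicValNat q i ! < j * w - e * padicValNat q j !) :
    ∃ n, padicValNat q m ≤ n ∧ q ^ n ≤ m ∧ w * q ^ n = e * padicValNat q (q ^ n)! := by
  have hq1 := hq.out.one_lt
  obtain ⟨i, hi, hmin⟩ := Finset.exists_min_image (Finset.range (m + 1))
    (fun i : ℕ => i * w - e * padicValNat q i !) ⟨0, by simp⟩
  simp only [Finset.mem_range, Nat.lt_succ_iff] at hi hmin
  push Not at h
  obtain ⟨j, hj, hji, hle⟩ := h i hi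
  have hmin' : ∀ l ≤ m, j * w - e * padicValNat q j ! ≤ l * w - e * padicValNat q l ! :=
    fun l hl => hle.trans (hmin l hl)
  -- The first alternative only ensures that a least `n` exists; it is excluded below. Minimality of
  -- `n` makes every minimizer a multiple of `q ^ n`.
  have hex : ∃ n, m < q ^ n ∨ w * q ^ n ≤ e * padicValNat q (q ^ n)! :=
    ⟨m, Or.inl (Nat.lt_pow_self hq1)⟩
  classical
  obtain ⟨n, hn, hleast⟩ : ∃ n, (m < q ^ n ∨ w * q ^ n ≤ e * padicValNat q (q ^ n)!) ∧
      ∀ l < n, ¬(m < q ^ l ∨ w * q ^ l ≤ e * padicValNat q (q ^ l)!) :=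
    ⟨Nat.find hex, Nat.find_spec hex, fun l hl => Nat.find_min hex hl⟩
  have hdvd : ∀ l ≤ m, (∀ j ≤ m, l * w - e * padicValNat q l ! ≤ j * w - e * padicValNat q j !) →
      q ^ n ∣ l := by
    intro l hl hlmin
    cases n with
    | zero => simp
    | succ n =>
      have := hleast n n.lt_succ_self
      push Not at this
      exact pow_succ_dvd_of_minimizer he.le hl hlmin this.2
  obtain ⟨a, rfl⟩ := hdvd i hi hmin
  obtain ⟨b, rfl⟩ := hdvd j hj hmin'
  have hqn : 0 < q ^ n := pow_pos hq.out.pos n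
  -- Distinct multiples of `q ^ n` differ by at least `q ^ n`, so the smaller minimizer leaves room
  -- for one more step inside `[0, m]`.
  have hnear : ¬(m < q ^ n * a + q ^ n ∧ m < q ^ n * b + q ^ n) := by
    rintro ⟨h1, h2⟩
    have h3 : a < b + 1 := lt_of_mul_lt_mul_left (a := q ^ n) (by rw [mul_add]; omega) hqn.le
    have h4 : b < a + 1 := lt_of_mul_lt_mul_left (a := q ^ n) (by rw [mul_add]; omega) hqn.le
    exact hji (by rw [show b = a by omega])
  have hnm : q ^ n ≤ m := by
    by_contra hlt
    exact hnear ⟨by omega, by omega⟩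
  have hn' := hn.resolve_left (not_lt.2 hnm)
  have heq : w * q ^ n = e * padicValNat q (q ^ n)! := by
    refine le_antisymm hn' (not_lt.1 fun hlt => hnear ⟨?_, ?_⟩)
    · exact not_le.1 fun h1 => absurd (slope_le_of_minimizer he.le hmin h1) (not_le.2 hlt)
    · exact not_le.1 fun h1 => absurd (slope_le_of_minimizer he.le hmin' h1) (not_le.2 hlt)
  refine ⟨n, not_lt.1 fun hk => ?_, hnm, heq⟩
  have hslope : w * q ^ padicValNat q m <
      e * padicValNat q (q ^ padicValNat q m)! := by
    have h1 : (padicValNat q (q ^ n)! * q ^ padicValNat q m : ℤ) <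
        padicValNat q (q ^ padicValNat q m)! * q ^ n :=
      mod_cast padicValNat_factorial_prime_pow_slope_lt hk
    have h2 := mul_lt_mul_of_pos_left h1 he
    refine lt_of_mul_lt_mul_right (a := (q : ℤ) ^ n) ?_ (by positivity)
    calc w * q ^ padicValNat q m * q ^ n = (w * q ^ n) * q ^ padicValNat q m := by ring
      _ < _ := by rw [heq]; linarith
  exact hji ((eq_of_minimizer_of_slope_lt he.le hj hmin' pow_padicValNat_dvd hslope).trans
    (eq_of_minimizer_of_slope_lt he.le hi hmin pow_padicValNat_dvd hslope).symm)

end FactorialValuation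

/-! ### Valuations of roots and of their preimages under `f` -/

section Valuation

open WithZero

variable {K : Type*} [Field K] [CharZero K] {v : Valuation K ℤᵐ⁰} {q : ℕ}

theorem Valuation.map_natCast_le_one (v : Valuation K ℤᵐ⁰) (n : ℕ) : v (n : K) ≤ 1 := by
  induction n with
  | zero => simp
  | succ n ih =>
    rw [Nat.cast_succ]
    exact v.map_add_le ih v.map_one.le

theorem Valuation.map_natCast_eq_one_of_coprime (hvq : v (q : K) < 1) {n : ℕ}
    (hn : n.Coprime q) : v (n : K) = 1 := by
  refine (v.map_natCast_le_one n).antisymm (not_lt.1 fun hlt => ?_)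
  have h := Nat.gcd_eq_gcd_ab n q
  rw [hn.gcd_eq_one] at h
  have hint : ∀ z : ℤ, v (z : K) ≤ 1 := by
    intro z
    cases z with
    | ofNat n => simpa using v.map_natCast_le_one n
    | negSucc n =>
      rw [Int.cast_negSucc, v.map_neg]
      exact v.map_natCast_le_one _
  have h' : (1 : K) = n * (n.gcdA q : ℤ) + q * (n.gcdB q : ℤ) := by exact_mod_cast h
  have h1 : v (1 : K) < 1 := by
    rw [h']
    refine v.map_add_lt ?_ ?_ <;> rw [map_mul]
    · exact (mul_le_of_le_one_right' (hint _)).trans_lt hlt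
    · exact (mul_le_of_le_one_right' (hint _)).trans_lt hvq
  exact absurd v.map_one h1.ne

variable [hq : Fact q.Prime] {e : ℤ}

theorem Valuation.map_natCast_eq_exp (he : 0 < e) (hvq : v (q : K) = exp (-e)) {n : ℕ}
    (hn : n ≠ 0) : v (n : K) = exp (-(e * padicValNat q n)) := by
  obtain ⟨k, b, hb, rfl⟩ := Nat.exists_eq_pow_mul_and_not_dvd hn q hq.out.ne_one
  have hb0 : b ≠ 0 := by rintro rfl; simp at hb
  have hlt : v (q : K) < 1 := by
    rw [hvq, ← exp_zero, exp_lt_exp]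
    omega
  rw [padicValNat.mul (pow_ne_zero _ hq.out.ne_zero) hb0, padicValNat.prime_pow,
    padicValNat.eq_zero_of_not_dvd hb, Nat.cast_mul, Nat.cast_pow, map_mul, map_pow, hvq,
    Valuation.map_natCast_eq_one_of_coprime hlt
      ((Nat.Prime.coprime_iff_not_dvd hq.out).2 hb).symm, ← exp_nsmul]
  simp [mul_comm]

theorem Valuation.map_ratCast_eq_exp [Algebra ℚ K] (he : 0 < e) (hvq : v (q : K) = exp (-e)) {r : ℚ}
    (hr : r ≠ 0) : v (algebraMap ℚ K r) = exp (-(e * padicValRat q r)) := by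
  have hnum : v ((r.num : ℤ) : K) = v ((r.num.natAbs : ℕ) : K) := by
    rcases Int.natAbs_eq r.num with h | h
    · conv_lhs => rw [h]
      simp
    · conv_lhs => rw [h]
      simp
  rw [eq_ratCast, Rat.cast_def, map_div₀, hnum,
    Valuation.map_natCast_eq_exp he hvq (by simpa using hr),
    Valuation.map_natCast_eq_exp he hvq r.den_nz, ← exp_sub, padicValRat_def, padicValInt]
  congr 1
  ring

/-- A vanishing sum cannot have a single dominant term, so the minimizer in `exists_slope_eq` is not
unique. -/
theorem exists_slope_eq_of_aeval_truncatedExp_eq_zero (he : 0 < e) (hvq : v (q : K) = exp (-e))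
    {m : ℕ} {α : K} [Algebra ℚ K] (hα : aeval α (truncatedExp m) = 0) :
    ∃ (w : ℤ) (n : ℕ), v α = exp (-w) ∧ padicValNat q m ≤ n ∧ q ^ n ≤ m ∧
      w * q ^ n = e * padicValNat q (q ^ n).factorial := by
  have hsum : ∑ i ∈ Finset.range (m + 1), α ^ i / (i.factorial : K) = 0 := by
    rw [← hα, truncatedExp, map_sum]
    refine Finset.sum_congr rfl fun i _ => ?_
    simp [div_eq_inv_mul]
  have hα0 : α ≠ 0 := by
    rintro rfl
    rw [Finset.sum_range_succ'] at hsum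
    simp at hsum
  obtain ⟨w, hw⟩ : ∃ w : ℤ, v α = exp (-w) :=
    ⟨-log (v α), by rw [neg_neg, exp_log (v.ne_zero_iff.2 hα0)]⟩
  have hterm : ∀ i : ℕ, v (α ^ i / (i.factorial : K)) =
      exp (-(i * w - e * padicValNat q i.factorial)) := by
    intro i
    rw [map_div₀, map_pow, hw, Valuation.map_natCast_eq_exp he hvq i.factorial_ne_zero,
      ← exp_nsmul, ← exp_sub]
    congr 1
    simp
    ring
  obtain ⟨n, h1, h2, h3⟩ := exists_slope_eq (q := q) (m := m) (w := w) he (by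
    rintro ⟨i, hi, hlt⟩
    have h := v.map_sum_eq_of_lt (s := Finset.range (m + 1))
      (f := fun i => α ^ i / (i.factorial : K)) (j := i) (by simpa [Nat.lt_succ_iff] using hi)
      (by
        intro j hj
        simp only [Finset.mem_sdiff, Finset.mem_range, Finset.mem_singleton] at hj
        rw [hterm, hterm, exp_lt_exp, neg_lt_neg_iff]
        exact hlt j (by omega) hj.2)
    rw [hsum, map_zero, hterm] at h
    exact exp_ne_zero h.symm)
  exact ⟨w, n, hw, h1, h2, h3⟩

/-- Once `γ` is integral, the lower terms of `f(γ)` have additive valuation at least `e > w`, so the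
leading term alone has valuation `w`. -/
theorem Valuation.natDegree_mul_eq_of_aeval [Algebra ℚ K] (he : 0 < e)
    (hvq : v (q : K) = exp (-e)) {f : ℚ[X]} (hd : 0 < f.natDegree)
    (hlead : padicValRat q f.leadingCoeff = 0)
    (hcoeff : ∀ i < f.natDegree, f.coeff i = 0 ∨ 0 < padicValRat q (f.coeff i))
    {γ : K} {w : ℤ} (hw0 : 0 < w) (hwe : w < e) (hγ : v (aeval γ f) = exp (-w)) :
    ∃ u : ℤ, 0 < u ∧ u < e ∧ v γ = exp (-u) ∧ f.natDegree * u = w := by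
  have hf : f ≠ 0 := by rintro rfl; simp at hd
  have hle : ∀ i < f.natDegree, v (algebraMap ℚ K (f.coeff i)) ≤ exp (-e) := by
    intro i hi
    rcases hcoeff i hi with h | h
    · simp [h]
    · rw [Valuation.map_ratCast_eq_exp he hvq (by rintro h0; simp [h0] at h), exp_le_exp,
        neg_le_neg_iff]
      nlinarith
  have htop : v (algebraMap ℚ K f.leadingCoeff) = 1 := by
    rw [Valuation.map_ratCast_eq_exp he hvq (leadingCoeff_ne_zero.2 hf), hlead]
    simp
  have hsum : aeval γ f = ∑ i ∈ Finset.range f.natDegree, algebraMap ℚ K (f.coeff i) * γ ^ i +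
      algebraMap ℚ K f.leadingCoeff * γ ^ f.natDegree := by
    rw [aeval_eq_sum_range, Finset.sum_range_succ]
    simp [Algebra.smul_def]
  have htopv : v (algebraMap ℚ K f.leadingCoeff * γ ^ f.natDegree) = v γ ^ f.natDegree := by
    rw [map_mul, map_pow, htop, one_mul]
  have hlt1 : exp (-e) < (1 : ℤᵐ⁰) := by
    rw [← exp_zero, exp_lt_exp]
    omega
  have hγ1 : v γ ≤ 1 := by
    -- For non-integral `γ` the leading term dominates, so `f(γ)` would be non-integral too, against
    -- `0 < w`.
    by_contra hgt
    rw [not_le] at hgt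
    have hlow : v (∑ i ∈ Finset.range f.natDegree, algebraMap ℚ K (f.coeff i) * γ ^ i) <
        v γ ^ f.natDegree := by
      refine v.map_sum_lt (pow_ne_zero _ (zero_lt_one.trans hgt).ne') fun i hi => ?_
      rw [Finset.mem_range] at hi
      rw [map_mul, map_pow]
      calc _ ≤ 1 * v γ ^ i := mul_le_mul_left ((hle i hi).trans hlt1.le) _
        _ < v γ ^ f.natDegree := by rw [one_mul]; exact pow_lt_pow_right₀ hgt hi
    rw [hsum, v.map_add_eq_of_lt_right (by rwa [htopv]), htopv] at hγ
    have h1 : (1 : ℤᵐ⁰) < exp (-w) := by rw [← hγ]; exact one_lt_pow₀ hgt hd.ne'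
    rw [← exp_zero, exp_lt_exp] at h1
    omega
  have hlow : v (∑ i ∈ Finset.range f.natDegree, algebraMap ℚ K (f.coeff i) * γ ^ i) ≤
      exp (-e) := by
    refine v.map_sum_le fun i hi => ?_
    rw [Finset.mem_range] at hi
    rw [map_mul, map_pow]
    calc _ ≤ exp (-e) * 1 := mul_le_mul' (hle i hi) (pow_le_one' hγ1 i)
      _ = _ := mul_one _
  have heq : v γ ^ f.natDegree = exp (-w) := by
    rw [← htopv, ← hγ, hsum]
    symm
    refine v.map_add_eq_of_lt_right (hlow.trans_lt (not_le.1 fun h => ?_))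
    have := v.map_add_le hlow h
    rw [← hsum, hγ, exp_le_exp] at this
    omega
  have hγ0 : v γ ≠ 0 := by
    intro h
    rw [h, zero_pow hd.ne'] at heq
    exact exp_ne_zero heq.symm
  obtain ⟨u, hu⟩ : ∃ u : ℤ, v γ = exp (-u) := ⟨-log (v γ), by rw [neg_neg, exp_log hγ0]⟩
  rw [hu, ← exp_nsmul, exp_inj] at heq
  have hmul : f.natDegree * u = w := by simpa using heq
  have hd' : (1 : ℤ) ≤ f.natDegree := by exact_mod_cast hd
  have hu0 : 0 < u := by
    by_contra h
    nlinarith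
  exact ⟨u, hu0, by nlinarith, hu, hmul⟩

theorem Valuation.natDegree_pow_mul_eq_of_aeval_polyIterate [Algebra ℚ K] (he : 0 < e)
    (hvq : v (q : K) = exp (-e)) {f : ℚ[X]} (hd : 0 < f.natDegree)
    (hlead : padicValRat q f.leadingCoeff = 0)
    (hcoeff : ∀ i < f.natDegree, f.coeff i = 0 ∨ 0 < padicValRat q (f.coeff i))
    (n : ℕ) {γ : K} {w : ℤ} (hw0 : 0 < w) (hwe : w < e)
    (hγ : v (aeval γ (polyIterate f n)) = exp (-w)) :
    ∃ u : ℤ, (f.natDegree ^ n : ℕ) * u = w := by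
  induction n generalizing w with
  | zero => exact ⟨w, by simp⟩
  | succ n ih =>
    rw [polyIterate, aeval_comp] at hγ
    obtain ⟨u, hu0, hue, hu, rfl⟩ :=
      Valuation.natDegree_mul_eq_of_aeval he hvq hd hlead hcoeff hw0 hwe hγ
    obtain ⟨t, rfl⟩ := ih hu0 hue hu
    exact ⟨t, by push_cast; ring⟩

end Valuation

/-! ### From ramification indices to degrees and irreducibility -/

section Degree

open WithZero NumberField

theorem dvd_finrank_of_forall_valuation (K : Type*) [Field K] [NumberField K] {q : ℕ}
    (hq : q.Prime) {N : ℕ}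
    (h : ∀ (v : Valuation K ℤᵐ⁰) (e : ℕ), 0 < e → v (q : K) = exp (-(e : ℤ)) → N ∣ e) :
    N ∣ Module.finrank ℚ K := by
  have hqZ : Prime (q : ℤ) := Nat.prime_iff_prime_int.1 hq
  let I : Ideal ℤ := Ideal.span {(q : ℤ)}
  have hI : I.IsPrime := (Ideal.span_singleton_prime hqZ.ne_zero).2 hqZ
  have hI0 : I ≠ ⊥ := by simpa [I] using hq.ne_zero
  let : Fintype (I.primesOver (𝓞 K)) := (Algebra.QuasiFinite.finite_primesOver I).fintype
  rw [← RingOfIntegers.rank K, ← Ideal.sum_ramification_inertia_eq_finrank I (𝓞 K)]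
  refine Finset.dvd_sum fun P _ => Dvd.dvd.mul_right ?_ _
  have hP : P.1.IsPrime := P.2.1
  have hPI : P.1.LiesOver I := P.2.2
  have hmap : I.map (algebraMap ℤ (𝓞 K)) = Ideal.span {(q : 𝓞 K)} := by
    simp [I, Ideal.map_span]
  have hmap0 : I.map (algebraMap ℤ (𝓞 K)) ≠ ⊥ := Ideal.map_ne_bot_of_ne_bot hI0
  have hP0 : P.1 ≠ ⊥ := Ideal.ne_bot_of_liesOver_of_ne_bot hI0 P.1
  let w : IsDedekindDomain.HeightOneSpectrum (𝓞 K) := ⟨P.1, hP, hP0⟩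
  refine h (w.valuation K) _ (Ideal.ramificationIdx_pos P.1 ℤ) ?_
  have hq0 : (q : 𝓞 K) ≠ 0 := Nat.cast_ne_zero.2 hq.ne_zero
  rw [show (q : K) = algebraMap (𝓞 K) K (q : 𝓞 K) by simp,
    IsDedekindDomain.HeightOneSpectrum.valuation_of_algebraMap,
    IsDedekindDomain.HeightOneSpectrum.intValuation_eq_exp_neg_multiplicity w hq0,
    Ideal.IsDedekindDomain.ramificationIdx_eq_multiplicity I P.1 hmap0, hmap]

/-- The valuation is `1 + q + ⋯ + q ^ (n - 1)`, congruent to `1` modulo `q`. -/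
theorem coprime_padicValNat_factorial_prime_pow {q : ℕ} [hq : Fact q.Prime] {n : ℕ}
    (hn : 0 < n) : (padicValNat q (q ^ n).factorial).Coprime q := by
  obtain ⟨n, rfl⟩ := Nat.exists_eq_succ_of_ne_zero hn.ne'
  induction n with
  | zero =>
    have := padicValNat_factorial_mul (p := q) 1
    simp_all
  | succ n ih =>
    rw [Nat.succ_eq_add_one, pow_succ', padicValNat_factorial_mul, pow_succ,
      Nat.coprime_add_mul_right_left]
    exact ih n.succ_pos

theorem padicValNat_factorial_prime_pow_lt {q : ℕ} [hq : Fact q.Prime] (n : ℕ) :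
    padicValNat q (q ^ n).factorial < q ^ n :=
  padicValNat_factorial_lt_of_ne_zero q (pow_ne_zero _ hq.out.ne_zero)

theorem padicValNat_factorial_prime_pow_pos {q : ℕ} [hq : Fact q.Prime] {n : ℕ} (hn : 0 < n) :
    0 < padicValNat q (q ^ n).factorial := by
  refine Nat.pos_of_ne_zero fun h => hq.out.ne_one ?_
  simpa [h] using coprime_padicValNat_factorial_prime_pow (q := q) hn

variable {K : Type*} [Field K] [NumberField K] {m : ℕ}

theorem dvd_finrank_of_aeval_truncatedExp_eq_zero {α : K}
    (hα : aeval α (truncatedExp m) = 0) (hm : m ≠ 0) : m ∣ Module.finrank ℚ K := by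
  rw [Nat.dvd_iff_prime_pow_dvd_dvd]
  intro q k hq hk
  have : Fact q.Prime := ⟨hq⟩
  rcases Nat.eq_zero_or_pos k with rfl | hk0
  · simp
  refine dvd_finrank_of_forall_valuation K hq fun v e he hv => ?_
  obtain ⟨w, n, -, hn, -, h⟩ := exists_slope_eq_of_aeval_truncatedExp_eq_zero
    (Int.natCast_pos.2 he) hv hα
  have hkn : k ≤ n := ((padicValNat_dvd_iff_le hm).1 hk).trans hn
  have h1 : q ^ n ∣ e * padicValNat q (q ^ n).factorial := by
    rw [← Int.natCast_dvd_natCast]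
    exact ⟨w, by simp only [Nat.cast_mul, Nat.cast_pow]; linarith⟩
  have h2 := (coprime_padicValNat_factorial_prime_pow (q := q) (hk0.trans_le hkn)).symm.pow_left n
  exact (pow_dvd_pow q hkn).trans (h2.dvd_of_dvd_mul_right h1)

theorem natDegree_pow_dvd_finrank_of_aeval_eq_zero {p : ℕ} (hp : p.Prime) (hpm : p ∣ m)
    (hm : m ≠ 0) {f : ℚ[X]} (hd : 0 < f.natDegree) (hlead : padicValRat p f.leadingCoeff = 0)
    (hcoeff : ∀ i < f.natDegree, f.coeff i = 0 ∨ 0 < padicValRat p (f.coeff i))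
    (hcop : f.natDegree.Coprime m.factorial) {n : ℕ} {β : K}
    (hβ : aeval (aeval β (polyIterate f n)) (truncatedExp m) = 0) :
    f.natDegree ^ n ∣ Module.finrank ℚ K := by
  have : Fact p.Prime := ⟨hp⟩
  refine dvd_finrank_of_forall_valuation K hp fun v e he hv => ?_
  have he' : (0 : ℤ) < e := Int.natCast_pos.2 he
  obtain ⟨w, k, hw, hmk, hkm, h⟩ := exists_slope_eq_of_aeval_truncatedExp_eq_zero he' hv hβ
  have hk : 0 < k := (one_le_padicValNat_of_dvd hm hpm).trans hmk
  have hlt := padicValNat_factorial_prime_pow_lt (q := p) k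
  have hpos := padicValNat_factorial_prime_pow_pos (q := p) hk
  -- The valuation is positive and below `p ^ k ≤ m`, so it divides `m!` and is coprime to the
  -- degree of `f`.
  have hdvd := Nat.dvd_factorial hpos (hlt.le.trans hkm)
  generalize padicValNat p (p ^ k).factorial = M at *
  have hpk : (0 : ℤ) < p ^ k := pow_pos (Int.natCast_pos.2 hp.pos) k
  have hpos' : (0 : ℤ) < M := Int.natCast_pos.2 hpos
  have hlt' : (M : ℤ) < p ^ k := by exact_mod_cast hlt
  have hw0 : 0 < w := by
    refine pos_of_mul_pos_left (b := (p : ℤ) ^ k) ?_ hpk.le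
    rw [h]
    exact mul_pos he' hpos'
  have hwe : w < e := by
    refine lt_of_mul_lt_mul_right (a := (p : ℤ) ^ k) ?_ hpk.le
    rw [h]
    exact mul_lt_mul_of_pos_left hlt' he'
  obtain ⟨u, hu⟩ := Valuation.natDegree_pow_mul_eq_of_aeval_polyIterate he' hv hd hlead hcoeff n
    hw0 hwe hw
  have h1 : f.natDegree ^ n ∣ e * M := by
    rw [← Int.natCast_dvd_natCast, Nat.cast_mul, ← h, ← hu, mul_assoc]
    exact dvd_mul_right _ _
  exact ((hcop.coprime_dvd_right hdvd).pow_left n).dvd_of_dvd_mul_right h1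

theorem natDegree_truncatedExp (m : ℕ) : (truncatedExp m).natDegree = m := by
  refine natDegree_eq_of_le_of_coeff_ne_zero ?_ ?_
  · refine natDegree_sum_le_of_forall_le _ _ fun i hi => (natDegree_C_mul_X_pow_le _ _).trans ?_
    have := Finset.mem_range.1 hi
    omega
  · simp [truncatedExp, Nat.factorial_ne_zero]

theorem natDegree_polyIterate (f : ℚ[X]) (n : ℕ) :
    (polyIterate f n).natDegree = f.natDegree ^ n := by
  induction n with
  | zero => simp [polyIterate]
  | succ n ih => rw [polyIterate, natDegree_comp, ih, pow_succ']

theorem Polynomial.irreducible_of_natDegree_dvd_finrank {F : ℚ[X]} (hF : F.natDegree ≠ 0)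
    (h : ∀ (K : Type) [Field K] [NumberField K] (β : K), aeval β F = 0 →
      F.natDegree ∣ Module.finrank ℚ K) : Irreducible F := by
  have hF0 : F ≠ 0 := by rintro rfl; simp at hF
  have hunit : ¬IsUnit F := fun hu => hF (natDegree_eq_zero_of_isUnit hu)
  obtain ⟨g, hg, r, hr⟩ := WfDvdMonoid.exists_irreducible_factor hunit hF0
  have : Fact (Irreducible g) := ⟨hg⟩
  have : FiniteDimensional ℚ (AdjoinRoot g) := (AdjoinRoot.powerBasis hg.ne_zero).finite
  have : NumberField (AdjoinRoot g) :=
    { to_charZero := inferInstance, to_finiteDimensional := this }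
  have hdvd := h (AdjoinRoot g) (AdjoinRoot.root g) (by
    rw [hr, map_mul, aeval_def, Subsingleton.elim (algebraMap ℚ (AdjoinRoot g)) (AdjoinRoot.of g),
      AdjoinRoot.eval₂_root, zero_mul])
  rw [(AdjoinRoot.powerBasis hg.ne_zero).finrank, AdjoinRoot.powerBasis_dim] at hdvd
  have hr0 : r ≠ 0 := by rintro rfl; simp [hr] at hF0
  have hle := Nat.le_of_dvd hg.natDegree_pos hdvd
  have hrdeg : r.natDegree = 0 := by
    have := natDegree_mul hg.ne_zero hr0
    rw [← hr] at this
    omega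
  have hru : IsUnit r := by
    rw [eq_C_of_natDegree_eq_zero hrdeg] at hr0 ⊢
    exact isUnit_C.2 (isUnit_iff_ne_zero.2 (by simpa using hr0))
  rw [hr]
  exact (irreducible_mul_isUnit hru).2 hg

end Degree

theorem mainTheorem10 (m : ℕ) (hm : 1 ≤ m) (p : ℕ) (hp : p.Prime) (hpm : p ∣ m)
    (f : ℚ[X]) (d : ℕ) (hd : f.natDegree = d)
    (hlead : padicValRat p (f.coeff d) = 0)
    (hcongr : PolyCongrMod p f (C (f.coeff d) * X ^ d))
    (hcop : Nat.Coprime d (Nat.factorial m)) :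
    DynamicallyIrreducibleAt f (truncatedExp m) := by
  subst hd
  have hm0 : m ≠ 0 := by omega
  have hd0 : 0 < f.natDegree := by
    -- Degree `0` would give `m! = 1`, impossible since `m ≥ p ≥ 2`.
    refine Nat.pos_of_ne_zero fun h => ?_
    rw [h, Nat.coprime_zero_left, Nat.factorial_eq_one] at hcop
    exact absurd (Nat.le_of_dvd (by omega) hpm) (by have := hp.two_le; omega)
  have hcoeff : ∀ i < f.natDegree, f.coeff i = 0 ∨ 0 < padicValRat p (f.coeff i) := by
    intro i hi
    have := hcongr i
    rwa [coeff_sub, coeff_C_mul_X_pow, if_neg hi.ne, sub_zero] at this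
  intro n
  have hdeg : ((truncatedExp m).comp (polyIterate f n)).natDegree = m * f.natDegree ^ n := by
    rw [natDegree_comp, natDegree_truncatedExp, natDegree_polyIterate]
  refine irreducible_of_natDegree_dvd_finrank (by rw [hdeg]; positivity) ?_
  intro K _ _ β hβ
  rw [aeval_comp] at hβ
  rw [hdeg]
  exact Nat.Coprime.mul_dvd_of_dvd_of_dvd
    ((hcop.coprime_dvd_right (Nat.dvd_factorial hm le_rfl)).pow_left n).symm
    (dvd_finrank_of_aeval_truncatedExp_eq_zero hβ hm0)
    (natDegree_pow_dvd_finrank_of_aeval_eq_zero hp hpm hm0 hd0 hlead hcoeff hcop hβ)
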